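/- Let $\mathbb K\in\{\mathbb R,\mathbb C\}$ and equip $\mathbb K^n$ with the scalar product $\langle x,y\rangle=y^*x$. A linear relation in $\mathbb K^n$ is a linear subspace $\mathcal M\subseteq\mathbb K^n\times\mathbb K^n$. It is called dissipative if $\operatorname{Re}\langle x,y\rangle\le 0$ for all $(x,y)\in\mathcal M$; maximally dissipative if it is dissipative and not a proper subspace of a dissipative linear relation; and nonnegative if it is symmetric, i.e. $\langle w,x\rangle=\langle v,y\rangle$ for all $(v,w),(x,y)\in\mathcal M$, and $\langle x,y\rangle\ge 0$ for all $(x,y)\in\mathcal M$. The product of two linear relations is $\mathcal D\mathcal L=\{(x,z) : \exists y,\ (x,y)\in\mathcal L,\ (y,z)\in\mathcal D\}$, and for $L\in\mathbb K^{n\times n}$ we write $(\operatorname{gr}L)^{-1}=\{(Lx,x): x\in\mathbb K^n\}$. A pencil $sE-A$ with $E,A\in\mathbb K^{n\times n}$ is regular if $\det(sE-A)$ is not the zero polynomial. Its spectrum $\sigma(E,A)$ is the set of all $\lambda\in\mathbb C$ with $\operatorname{rank}_{\mathbb C}(\lambda E-A)<\operatorname{rank}_{\mathbb K(s)}(sE-A)$.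 A regular pencil has a Weierstrass form over $\mathbb C$: there are invertible $S,T\in\mathbb C^{n\times n}$ with $S(sE-A)T=\operatorname{diag}(sI-J,\ sN-I)$, where $J$ is in Jordan canonical form and $N$ is block diagonal with nilpotent Jordan blocks. The sizes of the Jordan blocks of $J$ at $\lambda\in\mathbb C$ are called the sizes of the Jordan blocks of $sE-A$ at $\lambda$, and those of the blocks of $N$ the sizes of its Jordan blocks at $\infty$; they do not depend on the choice of $S,T$. An eigenvalue $\lambda$ is semi-simple if no Jordan block at $\lambda$ has size two or more. The index of $sE-A$ is the largest size of a Jordan block at $\infty$ ($0$ if there is none). **Proposition.** Let $E,A\in\mathbb K^{n\times n}$ be such that $$\operatorname{ran}\begin{bmatrix}E\\A\end{bmatrix}=\{(Ez,Az): z\in\mathbb K^n\}=\mathcal D\mathcal L$$ for some dissipative linear relation $\mathcal D$ and some nonnegative linear relation $\mathcal L$ in $\mathbb K^n$, and let $sE-A$ be regular. Then: (a) Every $\lambda\in\sigma(E,A)$ satisfies $\operatorname{Re}\lambda\le 0$; the non-zero eigenvalues on the imaginary axis are semi-simple; and the Jordan blocks at $0$ have size at most two. (b) The Jordan blocks at $\infty$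 have size at most three, i.e. the index of $sE-A$ is at most three. (c) If additionally $\mathcal D$ is maximally dissipative and $\mathcal L=(\operatorname{gr}L)^{-1}$ for some (Hermitian) positive definite $L\in\mathbb K^{n\times n}$, then the index of $sE-A$ is at most one and, if $0$ is an eigenvalue, it is semi-simple. -/

import Mathlib

open scoped ComplexOrder

/-! ### Linear relations in `𝕂ⁿ` -/

/-- A linear relation in `𝕂ⁿ`: a linear subspace of `𝕂ⁿ × 𝕂ⁿ`. -/
abbrev LinRel (𝕂 : Type*) [RCLike 𝕂] (n : ℕ) : Type _ :=
  Submodule 𝕂 ((Fin n → 𝕂) × (Fin n → 𝕂))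

namespace LinRel

variable {𝕂 : Type*} [RCLike 𝕂] {n : ℕ}

/-- The standard scalar product `⟨x, y⟩ = y^* x` on `𝕂ⁿ`. -/
def sp (x y : Fin n → 𝕂) : 𝕂 := star y ⬝ᵥ x

/-- The product `M L = {(x, z) | ∃ y, (x, y) ∈ L ∧ (y, z) ∈ M}`. -/
def prod (M L : LinRel 𝕂 n) : LinRel 𝕂 n where
  carrier := {p | ∃ y, (p.1, y) ∈ L ∧ (y, p.2) ∈ M}
  add_mem' := by
    rintro p q ⟨y, h1, h2⟩ ⟨y', h1', h2'⟩
    exact ⟨y + y', L.add_mem h1 h1', M.add_mem h2 h2'⟩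
  zero_mem' := ⟨0, L.zero_mem, M.zero_mem⟩
  smul_mem' := by
    rintro c p ⟨y, h1, h2⟩
    exact ⟨c • y, L.smul_mem c h1, M.smul_mem c h2⟩

/-- The inverse `M⁻¹ = {(y, x) | (x, y) ∈ M}`. -/
def inverse (M : LinRel 𝕂 n) : LinRel 𝕂 n where
  carrier := {p | (p.2, p.1) ∈ M}
  add_mem' := fun h1 h2 => M.add_mem h1 h2
  zero_mem' := M.zero_mem
  smul_mem' := fun c _ h => M.smul_mem c h

/-- The adjoint `M^* = {(x, y) | ⟨w, x⟩ = ⟨v, y⟩ for all (v, w) ∈ M}`. -/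
def adjoint (M : LinRel 𝕂 n) : LinRel 𝕂 n where
  carrier := {p | ∀ v w, (v, w) ∈ M → sp w p.1 = sp v p.2}
  add_mem' := by
    intro p q hp hq v w h
    have h1 := hp v w h
    have h2 := hq v w h
    simp only [sp] at h1 h2
    simp [sp, h1, h2]
  zero_mem' := by
    intro v w _
    simp [sp]
  smul_mem' := by
    intro c p hp v w h
    have h1 := hp v w h
    simp only [sp] at h1
    simp [sp, h1]

/-- The graph `{(x, M x) | x ∈ 𝕂ⁿ}` of a square matrix. -/
def gr (M : Matrix (Fin n) (Fin n) 𝕂) : LinRel 𝕂 n := M.mulVecLin.graph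

/-- The range `{(E z, A z) | z ∈ 𝕂ⁿ}` of the block column `[E; A]`. -/
def ranPair (E A : Matrix (Fin n) (Fin n) 𝕂) : LinRel 𝕂 n :=
  LinearMap.range (E.mulVecLin.prod A.mulVecLin)

/-- `M` is symmetric if `M ⊆ M^*`. -/
def IsSymmetric (M : LinRel 𝕂 n) : Prop := M ≤ M.adjoint

/-- `M` is dissipative if `Re ⟨x, y⟩ ≤ 0` for all `(x, y) ∈ M`. -/
def IsDissipative (M : LinRel 𝕂 n) : Prop :=
  ∀ x y, (x, y) ∈ M → RCLike.re (sp x y) ≤ 0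

/-- `M` is nonnegative if it is symmetric and `⟨x, y⟩ ≥ 0` (in particular real) for all
`(x, y) ∈ M`. -/
def IsNonneg (M : LinRel 𝕂 n) : Prop :=
  M.IsSymmetric ∧ ∀ x y, (x, y) ∈ M → 0 ≤ sp x y

/-- `M` is maximally dissipative if it is dissipative and not a proper subspace of a dissipative
linear relation. -/
def IsMaxDissipative (M : LinRel 𝕂 n) : Prop :=
  M.IsDissipative ∧ ∀ N : LinRel 𝕂 n, N.IsDissipative → ¬ M < N

end LinRel

/-! ### Matrix pencils `s E - A` -/

namespace Pencil

variable {𝕂 : Type*} [RCLike 𝕂] {n : ℕ}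

/-- The pencil `s E - A` is regular if `det (s E - A)` is not the zero polynomial. -/
def IsRegular (E A : Matrix (Fin n) (Fin n) 𝕂) : Prop :=
  ((Polynomial.X : Polynomial 𝕂) • E.map Polynomial.C - A.map Polynomial.C).det ≠ 0

/-- A matrix over `𝕂` (the real or complex numbers), regarded as a complex matrix. -/
noncomputable def toComplex (M : Matrix (Fin n) (Fin n) 𝕂) : Matrix (Fin n) (Fin n) ℂ :=
  M.map (RCLike.map 𝕂 ℂ)

/-- The set `σ(E, A)` of the eigenvalues of `s E - A`: all complex numbers `μ` such that the rank of
`μ E - A` over `ℂ` is smaller than the rank of `s E - A` over the field `𝕂(s)` of rational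
functions. -/
def spectrum (E A : Matrix (Fin n) (Fin n) 𝕂) : Set ℂ :=
  {μ | (μ • toComplex E - toComplex A).rank <
    ((RatFunc.X : RatFunc 𝕂) • E.map RatFunc.C - A.map RatFunc.C).rank}

/-- The `k × k` Jordan block with eigenvalue `μ`. -/
def jordanBlock (k : ℕ) (μ : ℂ) : Matrix (Fin k) (Fin k) ℂ :=
  Matrix.of fun i j => if i = j then μ else if (i : ℕ) + 1 = j then 1 else 0

/-- A Weierstrass form, i.e. a Kronecker form without row and column minimal indices, of the complex
pencil `s E - A`: invertible `S`, `T` with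
`S (s E - A) T = diag (s I - J, s N - I)`, where `J` is block diagonal with Jordan blocks of sizes
`finSize i` at the eigenvalues `eig i`, and `N` is block diagonal with nilpotent Jordan blocks of
sizes `infSize j`.  The bijection `e` orders the rows and columns of the block matrix. -/
structure WeierstrassForm (E A : Matrix (Fin n) (Fin n) ℂ) where
  numFin : ℕ
  finSize : Fin numFin → ℕ
  finSize_pos : ∀ i, 0 < finSize i
  eig : Fin numFin → ℂ
  numInf : ℕ
  infSize : Fin numInf → ℕ
  infSize_pos : ∀ j, 0 < infSize j
  e : ((Σ i, Fin (finSize i)) ⊕ (Σ j, Fin (infSize j))) ≃ Fin n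
  S : Matrix (Fin n) (Fin n) ℂ
  T : Matrix (Fin n) (Fin n) ℂ
  isUnit_S : IsUnit S
  isUnit_T : IsUnit T
  leading : S * E * T = Matrix.reindex e e
    (Matrix.fromBlocks 1 0 0 (Matrix.blockDiagonal' fun j => jordanBlock (infSize j) 0))
  constant : S * A * T = Matrix.reindex e e
    (Matrix.fromBlocks (Matrix.blockDiagonal' fun i => jordanBlock (finSize i) (eig i)) 0 0 1)

/-- `k` is the size of a Jordan block of `s E - A` at `μ ∈ ℂ`.  (The block sizes do not depend on the
chosen Weierstrass form; for real pencils, they are those of the complexified pencil.) -/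
def HasJordanBlock (E A : Matrix (Fin n) (Fin n) 𝕂) (μ : ℂ) (k : ℕ) : Prop :=
  ∃ W : WeierstrassForm (toComplex E) (toComplex A), ∃ i, W.eig i = μ ∧ W.finSize i = k

/-- `k` is the size of a Jordan block of `s E - A` at `∞`. -/
def HasJordanBlockAtInfinity (E A : Matrix (Fin n) (Fin n) 𝕂) (k : ℕ) : Prop :=
  ∃ W : WeierstrassForm (toComplex E) (toComplex A), ∃ j, W.infSize j = k

/-- An eigenvalue `μ` of `s E - A` is semi-simple if there is no Jordan block of size at least two
at `μ`. -/
def IsSemisimple (E A : Matrix (Fin n) (Fin n) 𝕂) (μ : ℂ) : Prop :=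
  ∀ k, 2 ≤ k → ¬ HasJordanBlock E A μ k

/-- The index of a regular pencil: the largest size of a Jordan block at `∞`, and `0` if there is no
such block. -/
noncomputable def index (E A : Matrix (Fin n) (Fin n) 𝕂) : ℕ :=
  sSup {k | HasJordanBlockAtInfinity E A k}

/-- The supremum in the definition of the index is over a bounded set. -/
theorem bddAbove_jordanBlockAtInfinity (E A : Matrix (Fin n) (Fin n) 𝕂) :
    BddAbove {k | HasJordanBlockAtInfinity E A k} := by
  refine ⟨n, ?_⟩
  rintro k ⟨W, j, rfl⟩
  have h : Function.Injective
      (fun x : Fin (W.infSize j) => W.e (Sum.inr ⟨j, x⟩)) := by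
    intro x y hxy
    simpa using hxy
  simpa using Fintype.card_le_of_injective _ h

end Pencil

/-!
Let `(x, y)` be an isotropic pair of a dissipative relation `M`, i.e. `Re ⟨x, y⟩ = 0`.  It maximizes
the form `Re ⟨·, ·⟩` on `M`, so polarization gives `⟨u, y⟩ + ⟨v, x⟩ = 0` for all `(u, v) ∈ M`.  For
isotropic pairs of a nonnegative relation, both terms vanish.  By `ranPair E A = 𝒟 ℒ`, a Jordan
chain `x 1, x 2, …` comes with `y 1, y 2, …` such that `(E (x a), y a) ∈ ℒ` and
`(y a, A (x a)) ∈ 𝒟`.  For an eigenvector `x 1` at `μ ≠ 0`, the energy `⟨E (x 1), y 1⟩` is positive,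
and dissipativity reads `Re μ ⟨E (x 1), y 1⟩ ≤ 0`.  In a chain that is too long, the chain relations
force the energies to vanish one after the other.  The corresponding `y a` are then orthogonal to
the ranges of `E` and `A`, hence zero by regularity, and this makes the eigenvector `x 1` zero.

Eigenvalues and Jordan blocks are complex, so the argument is applied to the complexified pencil and
relations.  An orthonormal basis of `ℂ` over `𝕂` expresses the real part of a complex scalar product
as the sum of the real parts of the scalar products of the coordinates, so that dissipativity and
nonnegativity survive complexification.
-/

namespace LinRel

open scoped Matrix

variable {𝕂 : Type*} [RCLike 𝕂] {n : ℕ}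

section ScalarProduct

variable (c : 𝕂) (x x' y y' : Fin n → 𝕂)

@[simp]
theorem sp_add_left : sp (x + x') y = sp x y + sp x' y := by simp [sp]

@[simp]
theorem sp_add_right : sp x (y + y') = sp x y + sp x y' := by simp [sp]

@[simp]
theorem sp_sub_left : sp (x - x') y = sp x y - sp x' y := by simp [sp]

@[simp]
theorem sp_neg_left : sp (-x) y = -sp x y := by simp [sp]

@[simp]
theorem sp_neg_right : sp x (-y) = -sp x y := by simp [sp]

@[simp]
theorem sp_smul_left : sp (c • x) y = c * sp x y := by simp [sp]

@[simp]
theorem sp_smul_right : sp x (c • y) = star c * sp x y := by simp [sp]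

@[simp]
theorem sp_zero_left : sp 0 y = 0 := by simp [sp]

@[simp]
theorem sp_zero_right : sp x 0 = 0 := by simp [sp]

theorem star_sp : star (sp x y) = sp y x := by
  rw [sp, sp, Matrix.star_dotProduct, star_star]

variable {x y}

theorem sp_eq_zero_comm : sp x y = 0 ↔ sp y x = 0 := by
  rw [← star_sp, star_eq_zero]

theorem sp_self_eq_zero : sp x x = 0 ↔ x = 0 := dotProduct_star_self_eq_zero

end ScalarProduct

section Polarization

variable {M : LinRel 𝕂 n} {x y u v : Fin n → 𝕂}

theorem eq_zero_of_forall_re_star_mul_le {b : 𝕂} {r : ℝ}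
    (h : ∀ c : 𝕂, RCLike.re (star c * b) ≤ r) : b = 0 := by
  by_contra hb
  have hpos : 0 < ‖b‖ ^ 2 := by positivity
  have hre : RCLike.re (star (((r + 1) / ‖b‖ ^ 2 : ℝ) * b) * b) = r + 1 := by
    rw [star_mul', mul_assoc, RCLike.star_def, RCLike.conj_mul, RCLike.conj_ofReal,
      ← RCLike.ofReal_pow, ← RCLike.ofReal_mul, div_mul_cancel₀ _ hpos.ne', RCLike.ofReal_re]
  linarith [h (((r + 1) / ‖b‖ ^ 2 : ℝ) * b)]

/-- An isotropic pair maximizes the form `Re ⟨·, ·⟩` on a dissipative relation, so the derivative of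
the form vanishes there. -/
theorem IsDissipative.sp_add_sp_eq_zero (hM : M.IsDissipative) (hxy : (x, y) ∈ M)
    (h0 : RCLike.re (sp x y) = 0) (huv : (u, v) ∈ M) : sp u y + sp v x = 0 := by
  refine eq_zero_of_forall_re_star_mul_le (r := -RCLike.re (sp u v)) fun c => ?_
  have hle : RCLike.re (sp (u + c • x) (v + c • y)) ≤ 0 :=
    hM _ _ (M.add_mem huv (M.smul_mem c hxy))
  have hcross : RCLike.re (c * sp x v) = RCLike.re (star c * sp v x) := by
    rw [← star_sp v x, ← RCLike.conj_re, ← RCLike.star_def, star_mul', star_star]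
  have hdiag : RCLike.re (star c * (c * sp x y)) = 0 := by
    rw [← mul_assoc, RCLike.star_def, RCLike.conj_mul, ← RCLike.ofReal_pow, RCLike.re_ofReal_mul,
      h0, mul_zero]
  simp only [sp_add_left, sp_add_right, sp_smul_left, sp_smul_right, mul_add, map_add] at hle ⊢
  linarith

theorem IsNonneg.isDissipative_comap_neg (hM : M.IsNonneg) :
    IsDissipative (M.comap (LinearMap.id.prodMap (-LinearMap.id))) := by
  intro x y h
  have h0 : 0 ≤ sp x (-y) := hM.2 _ _ h
  simpa using (RCLike.nonneg_iff.mp h0).1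

theorem IsNonneg.sp_eq_zero (hM : M.IsNonneg) (hxy : (x, y) ∈ M) (h0 : sp x y = 0)
    (huv : (u, v) ∈ M) : sp u y = 0 ∧ sp v x = 0 := by
  have hsymm : sp v x = sp u y := hM.1 hxy u v huv
  have hpolar : sp u (-y) + sp (-v) x = 0 := by
    apply hM.isDissipative_comap_neg.sp_add_sp_eq_zero <;> simp [hxy, huv, h0]
  have hsum : sp u y + sp u y = 0 := by
    rw [sp_neg_left, sp_neg_right, hsymm, ← neg_add, neg_eq_zero] at hpolar
    exact hpolar
  exact ⟨add_self_eq_zero.mp hsum, hsymm.trans (add_self_eq_zero.mp hsum)⟩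

end Polarization

theorem mem_prod_of_mem_ker {M N : LinRel 𝕂 n} {x : Fin n → 𝕂} (h : (x, 0) ∈ N) :
    (x, 0) ∈ M.prod N := ⟨0, h, M.zero_mem⟩

theorem mem_prod_of_mem_mul {M N : LinRel 𝕂 n} {x : Fin n → 𝕂} (h : (0, x) ∈ M) :
    (0, x) ∈ M.prod N := ⟨0, N.zero_mem, h⟩

/-- A relation is definite if its only pair `(x, y)` with `⟨x, y⟩ = 0` is `(0, 0)`.  The relation
`(gr L)⁻¹` is definite for every positive definite matrix `L`. -/
def IsDefinite (M : LinRel 𝕂 n) : Prop :=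
  ∀ x y, (x, y) ∈ M → sp x y = 0 → x = 0 ∧ y = 0

theorem isDefinite_inverse_gr {L : Matrix (Fin n) (Fin n) 𝕂} (hL : L.PosDef) :
    (gr L).inverse.IsDefinite := by
  rintro x y (rfl : x = L *ᵥ y) h0
  have hy : y = 0 := by
    by_contra hy
    exact (hL.dotProduct_mulVec_pos hy).ne' h0
  exact ⟨by rw [hy, Matrix.mulVec_zero], hy⟩

end LinRel

namespace Pencil

open LinRel
open scoped Matrix

/-- A Jordan chain `x 1, …, x k` of the pencil `s E - A` at `μ`, with the convention `x 0 = 0`; the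
later terms of the sequence are irrelevant.  The Jordan chains of `s E - A` at `∞` are the Jordan
chains of `s A - E` at `0`. -/
structure IsJordanChain {R m n : Type*} [Semiring R] [Fintype n] (E A : Matrix m n R) (μ : R)
    (k : ℕ) (x : ℕ → n → R) : Prop where
  zero : x 0 = 0
  one_ne_zero : x 1 ≠ 0
  mulVec_succ : ∀ a < k, A *ᵥ x (a + 1) = μ • E *ᵥ x (a + 1) + E *ᵥ x a

namespace IsJordanChain

variable {R m n : Type*} [Semiring R] [Fintype n] {E A : Matrix m n R} {μ : R} {k : ℕ}
  {x : ℕ → n → R}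

theorem mulVec_one (hx : IsJordanChain E A μ k x) (hk : 0 < k) : A *ᵥ x 1 = μ • E *ᵥ x 1 := by
  simpa [hx.zero] using hx.mulVec_succ 0 hk

theorem mulVec_succ_of_zero (hx : IsJordanChain E A 0 k x) {a : ℕ} (ha : a < k) :
    A *ᵥ x (a + 1) = E *ᵥ x a := by
  simpa using hx.mulVec_succ a ha

theorem mulVec_one_of_zero (hx : IsJordanChain E A 0 k x) (hk : 0 < k) : A *ᵥ x 1 = 0 := by
  simpa using hx.mulVec_one hk

end IsJordanChain

section Chains

variable {𝕂 : Type*} [RCLike 𝕂] {n : ℕ} {E A : Matrix (Fin n) (Fin n) 𝕂} {D L : LinRel 𝕂 n}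
  {s : 𝕂}

theorem exists_mem_mem_of_ranPair_eq (hran : ranPair E A = D.prod L) (z : Fin n → 𝕂) :
    ∃ y, (E *ᵥ z, y) ∈ L ∧ (y, A *ᵥ z) ∈ D := by
  have h : (E *ᵥ z, A *ᵥ z) ∈ ranPair E A := ⟨z, rfl⟩
  rwa [hran] at h

theorem eq_zero_of_mulVec_eq_smul (hs : IsUnit (s • E - A)) {z : Fin n → 𝕂}
    (h : A *ᵥ z = s • E *ᵥ z) : z = 0 := by
  apply Matrix.mulVec_injective_iff_isUnit.mpr hs
  rw [Matrix.sub_mulVec, Matrix.smul_mulVec, h, sub_self, Matrix.mulVec_zero]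

theorem eq_zero_of_mulVec_eq_zero (hs : IsUnit (s • E - A)) {z : Fin n → 𝕂}
    (hE : E *ᵥ z = 0) (hA : A *ᵥ z = 0) : z = 0 :=
  eq_zero_of_mulVec_eq_smul hs (by rw [hE, hA, smul_zero])

theorem eq_zero_of_mem_ranPair (hs : IsUnit (s • E - A)) {x : Fin n → 𝕂}
    (hker : (x, 0) ∈ ranPair E A) (hmul : (0, x) ∈ ranPair E A) : x = 0 := by
  obtain ⟨z, hz⟩ := hker
  obtain ⟨w, hw⟩ := hmul
  simp only [LinearMap.prod_apply, Function.prod_apply, Matrix.mulVecLin_apply, Prod.mk.injEq]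
    at hz hw
  have hzw : z + s • w = 0 := by
    apply eq_zero_of_mulVec_eq_smul hs
    simp [Matrix.mulVec_add, Matrix.mulVec_smul, hz, hw]
  simpa [Matrix.mulVec_add, Matrix.mulVec_smul, hz, hw] using congrArg (E *ᵥ ·) hzw

theorem eq_zero_of_orthogonal (hs : IsUnit (s • E - A)) {y : Fin n → 𝕂}
    (hE : ∀ z, sp (E *ᵥ z) y = 0) (hA : ∀ z, sp (A *ᵥ z) y = 0) : y = 0 := by
  obtain ⟨z, hz⟩ := Matrix.mulVec_surjective_iff_isUnit.mpr hs y
  rw [← sp_self_eq_zero]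
  calc sp y y = sp ((s • E - A) *ᵥ z) y := by rw [hz]
    _ = s * sp (E *ᵥ z) y - sp (A *ᵥ z) y := by
      rw [Matrix.sub_mulVec, Matrix.smul_mulVec, sp_sub_left, sp_smul_left]
    _ = 0 := by rw [hE, hA, mul_zero, sub_zero]

/-- By polarization, `y` is orthogonal to the ranges of `E` and `A`. -/
theorem eq_zero_of_isotropic (hD : D.IsDissipative) (hran : ranPair E A = D.prod L)
    (hs : IsUnit (s • E - A)) {x y : Fin n → 𝕂} (hyx : (y, x) ∈ D)
    (h0 : RCLike.re (sp y x) = 0) (hy : ∀ p r, (p, r) ∈ L → sp p y = 0)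
    (hx : ∀ p r, (p, r) ∈ L → sp r x = 0) : y = 0 := by
  refine eq_zero_of_orthogonal hs (fun z => ?_) fun z => ?_ <;>
    obtain ⟨r, hr, hd⟩ := exists_mem_mem_of_ranPair_eq hran z
  · exact hy _ _ hr
  · simpa [hx _ _ hr] using hD.sp_add_sp_eq_zero hyx h0 hd

section Eigenvector

variable {z : Fin n → 𝕂} {μ : 𝕂}

theorem sp_ne_zero_of_eigenvector (hD : D.IsDissipative) (hL : L.IsNonneg)
    (hran : ranPair E A = D.prod L) (hs : IsUnit (s • E - A)) (hz : z ≠ 0) (hμ : μ ≠ 0)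
    (hA : A *ᵥ z = μ • E *ᵥ z) {y : Fin n → 𝕂} (hl : (E *ᵥ z, y) ∈ L)
    (hd : (y, μ • E *ᵥ z) ∈ D) : sp (E *ᵥ z) y ≠ 0 := by
  intro h0
  have horth {p r : Fin n → 𝕂} (h : (p, r) ∈ L) := hL.sp_eq_zero hl h0 h
  obtain rfl : y = 0 := by
    refine eq_zero_of_isotropic hD hran hs hd ?_ (fun p r h => (horth h).1) fun p r h => ?_
    · rw [sp_smul_right, sp_eq_zero_comm.mp h0, mul_zero, map_zero]
    · rw [sp_smul_right, (horth h).2, mul_zero]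
  have hd' : (0, E *ᵥ z) ∈ D := by simpa [smul_smul, hμ] using D.smul_mem μ⁻¹ hd
  have hEz : E *ᵥ z = 0 := by
    apply eq_zero_of_mem_ranPair hs <;> rw [hran]
    exacts [mem_prod_of_mem_ker hl, mem_prod_of_mem_mul hd']
  exact hz (eq_zero_of_mulVec_eq_zero hs hEz (by rw [hA, hEz, smul_zero]))

/-- With `(E z, y) ∈ L` and `(y, μ E z) ∈ D`, dissipativity reads `Re μ ⟨E z, y⟩ ≤ 0`, where
`⟨E z, y⟩ > 0`. -/
theorem re_nonpos_of_eigenvector (hD : D.IsDissipative) (hL : L.IsNonneg)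
    (hran : ranPair E A = D.prod L) (hs : IsUnit (s • E - A)) (hz : z ≠ 0)
    (hA : A *ᵥ z = μ • E *ᵥ z) : RCLike.re μ ≤ 0 := by
  rcases eq_or_ne μ 0 with rfl | hμ
  · rw [map_zero]
  obtain ⟨y, hl, hd⟩ := exists_mem_mem_of_ranPair_eq hran z
  rw [hA] at hd
  have hpos : 0 < sp (E *ᵥ z) y :=
    (hL.2 _ _ hl).lt_of_ne' (sp_ne_zero_of_eigenvector hD hL hran hs hz hμ hA hl hd)
  obtain ⟨hre, him⟩ := RCLike.pos_iff.mp hpos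
  have hdiss : RCLike.re μ * RCLike.re (sp (E *ᵥ z) y) ≤ 0 := by
    simpa [← star_sp (E *ᵥ z) y, him] using hD _ _ hd
  exact nonpos_of_mul_nonpos_left hdiss hre

end Eigenvector

namespace IsJordanChain

variable {μ : 𝕂} {k : ℕ} {x : ℕ → Fin n → 𝕂}

/-- Polarizing at the isotropic pair of the eigenvector `x 1` and testing with `x 2` leaves
`⟨E (x 1), y⟩ = 0`, because `star μ + μ = 0`. -/
theorem length_le_one_of_re_eq_zero (hx : IsJordanChain E A μ k x) (hD : D.IsDissipative)
    (hL : L.IsNonneg) (hran : ranPair E A = D.prod L) (hs : IsUnit (s • E - A))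
    (hre : RCLike.re μ = 0) (hμ : μ ≠ 0) : k ≤ 1 := by
  by_contra! hk
  obtain ⟨y₁, hl₁, hd₁⟩ := exists_mem_mem_of_ranPair_eq hran (x 1)
  obtain ⟨y₂, hl₂, hd₂⟩ := exists_mem_mem_of_ranPair_eq hran (x 2)
  have hA₁ := hx.mulVec_one (by lia)
  rw [hA₁] at hd₁
  rw [hx.mulVec_succ 1 hk] at hd₂
  have hne := sp_ne_zero_of_eigenvector hD hL hran hs hx.one_ne_zero hμ hA₁ hl₁ hd₁
  have him : RCLike.im (sp (E *ᵥ x 1) y₁) = 0 := (RCLike.nonneg_iff.mp (hL.2 _ _ hl₁)).2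
  have hiso : RCLike.re (sp y₁ (μ • E *ᵥ x 1)) = 0 := by
    rw [sp_smul_right, ← star_sp]
    simp [hre, him]
  have hμstar : star μ + μ = 0 := by
    rw [RCLike.star_def, add_comm, RCLike.add_conj, hre, RCLike.ofReal_zero, mul_zero]
  have hsymm : sp y₂ (E *ᵥ x 1) = sp (E *ᵥ x 2) y₁ := hL.1 hl₁ _ _ hl₂
  refine hne ?_
  calc sp (E *ᵥ x 1) y₁
      = (star μ + μ) * sp (E *ᵥ x 2) y₁ + sp (E *ᵥ x 1) y₁ := by rw [hμstar, zero_mul, zero_add]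
    _ = sp y₂ (μ • E *ᵥ x 1) + sp (μ • E *ᵥ x 2 + E *ᵥ x 1) y₁ := by
      rw [sp_smul_right, sp_add_left, sp_smul_left, hsymm]
      ring
    _ = 0 := hD.sp_add_sp_eq_zero hd₁ hiso hd₂

theorem length_le_two (hx : IsJordanChain E A 0 k x) (hD : D.IsDissipative)
    (hL : L.IsNonneg) (hran : ranPair E A = D.prod L) (hs : IsUnit (s • E - A)) : k ≤ 2 := by
  by_contra! hk
  obtain ⟨y₁, hl₁, hd₁⟩ := exists_mem_mem_of_ranPair_eq hran (x 1)
  obtain ⟨y₂, hl₂, hd₂⟩ := exists_mem_mem_of_ranPair_eq hran (x 2)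
  obtain ⟨y₃, hl₃, hd₃⟩ := exists_mem_mem_of_ranPair_eq hran (x 3)
  have hA₁ : A *ᵥ x 1 = 0 := hx.mulVec_one_of_zero (by lia)
  rw [hA₁] at hd₁
  rw [hx.mulVec_succ_of_zero (by lia)] at hd₂ hd₃
  have hy₁ : sp (E *ᵥ x 1) y₁ = 0 := by simpa using hD.sp_add_sp_eq_zero hd₁ (by simp) hd₂
  have horth₁ {p r : Fin n → 𝕂} (h : (p, r) ∈ L) := hL.sp_eq_zero hl₁ hy₁ h
  have hiso₂ : RCLike.re (sp y₂ (E *ᵥ x 1)) = 0 := by rw [(horth₁ hl₂).2, map_zero]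
  have hy₂ : sp (E *ᵥ x 2) y₂ = 0 := by
    simpa [(horth₁ hl₃).2] using hD.sp_add_sp_eq_zero hd₂ hiso₂ hd₃
  obtain rfl : y₂ = 0 := eq_zero_of_isotropic hD hran hs hd₂ hiso₂
    (fun p r h => (hL.sp_eq_zero hl₂ hy₂ h).1) fun p r h => (horth₁ h).2
  have hE₁ : E *ᵥ x 1 = 0 :=
    eq_zero_of_mem_ranPair hs ⟨x 1, Prod.ext rfl hA₁⟩ (hran ▸ mem_prod_of_mem_mul hd₂)
  exact hx.one_ne_zero (eq_zero_of_mulVec_eq_zero hs hE₁ hA₁)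

theorem length_le_three (hx : IsJordanChain A E 0 k x) (hD : D.IsDissipative)
    (hL : L.IsNonneg) (hran : ranPair E A = D.prod L) (hs : IsUnit (s • E - A)) : k ≤ 3 := by
  by_contra! hk
  obtain ⟨y₁, hl₁, hd₁⟩ := exists_mem_mem_of_ranPair_eq hran (x 1)
  obtain ⟨y₂, hl₂, hd₂⟩ := exists_mem_mem_of_ranPair_eq hran (x 2)
  obtain ⟨y₃, hl₃, hd₃⟩ := exists_mem_mem_of_ranPair_eq hran (x 3)
  obtain ⟨y₄, hl₄, -⟩ := exists_mem_mem_of_ranPair_eq hran (x 4)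
  have hE₁ : E *ᵥ x 1 = 0 := hx.mulVec_one_of_zero (by lia)
  rw [hE₁] at hl₁
  rw [hx.mulVec_succ_of_zero (by lia)] at hl₂ hl₃ hl₄
  have horth₁ {p r : Fin n → 𝕂} (h : (p, r) ∈ L) := hL.sp_eq_zero hl₁ (sp_zero_left _) h
  have hiso₁ : RCLike.re (sp y₁ (A *ᵥ x 1)) = 0 := by
    rw [sp_eq_zero_comm.mp (horth₁ hl₂).1, map_zero]
  have hy₂ : sp (A *ᵥ x 1) y₂ = 0 := by
    rw [sp_eq_zero_comm]
    simpa [(horth₁ hl₃).1] using hD.sp_add_sp_eq_zero hd₁ hiso₁ hd₂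
  have horth₂ {p r : Fin n → 𝕂} (h : (p, r) ∈ L) := hL.sp_eq_zero hl₂ hy₂ h
  have hiso₂ : RCLike.re (sp y₂ (A *ᵥ x 2)) = 0 := by
    rw [sp_eq_zero_comm.mp (horth₂ hl₃).1, map_zero]
  have hy₃ : sp (A *ᵥ x 2) y₃ = 0 := by
    rw [sp_eq_zero_comm]
    simpa [(horth₂ hl₄).1] using hD.sp_add_sp_eq_zero hd₂ hiso₂ hd₃
  obtain rfl : y₁ = 0 := eq_zero_of_isotropic hD hran hs hd₁ hiso₁
    (fun p r h => (horth₁ h).1) fun p r h => (horth₂ h).2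
  obtain rfl : y₂ = 0 := eq_zero_of_isotropic hD hran hs hd₂ hiso₂
    (fun p r h => (horth₂ h).1) fun p r h => (hL.sp_eq_zero hl₃ hy₃ h).2
  have hA₁ : A *ᵥ x 1 = 0 := by
    apply eq_zero_of_mem_ranPair hs <;> rw [hran]
    exacts [mem_prod_of_mem_ker hl₂, mem_prod_of_mem_mul hd₁]
  exact hx.one_ne_zero (eq_zero_of_mulVec_eq_zero hs hE₁ hA₁)

theorem length_le_one_of_isDefinite (hx : IsJordanChain E A 0 k x) (hD : D.IsDissipative)
    (hL : L.IsDefinite) (hran : ranPair E A = D.prod L) (hs : IsUnit (s • E - A)) : k ≤ 1 := by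
  by_contra! hk
  obtain ⟨y₁, hl₁, hd₁⟩ := exists_mem_mem_of_ranPair_eq hran (x 1)
  obtain ⟨y₂, -, hd₂⟩ := exists_mem_mem_of_ranPair_eq hran (x 2)
  have hA₁ : A *ᵥ x 1 = 0 := hx.mulVec_one_of_zero (by lia)
  rw [hA₁] at hd₁
  rw [hx.mulVec_succ_of_zero hk] at hd₂
  have hy₁ : sp (E *ᵥ x 1) y₁ = 0 := by simpa using hD.sp_add_sp_eq_zero hd₁ (by simp) hd₂
  exact hx.one_ne_zero (eq_zero_of_mulVec_eq_zero hs (hL _ _ hl₁ hy₁).1 hA₁)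

theorem length_le_one_of_isDefinite_at_infinity (hx : IsJordanChain A E 0 k x)
    (hD : D.IsDissipative) (hL : L.IsDefinite) (hran : ranPair E A = D.prod L)
    (hs : IsUnit (s • E - A)) : k ≤ 1 := by
  by_contra! hk
  obtain ⟨y₁, hl₁, hd₁⟩ := exists_mem_mem_of_ranPair_eq hran (x 1)
  obtain ⟨y₂, hl₂, hd₂⟩ := exists_mem_mem_of_ranPair_eq hran (x 2)
  have hE₁ : E *ᵥ x 1 = 0 := hx.mulVec_one_of_zero (by lia)
  rw [hE₁] at hl₁
  rw [hx.mulVec_succ_of_zero hk] at hl₂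
  obtain rfl : y₁ = 0 := (hL _ _ hl₁ (sp_zero_left _)).2
  have hy₂ : sp y₂ (A *ᵥ x 1) = 0 := by simpa using hD.sp_add_sp_eq_zero hd₁ (by simp) hd₂
  have hA₁ : A *ᵥ x 1 = 0 := (hL _ _ hl₂ (sp_eq_zero_comm.mp hy₂)).1
  exact hx.one_ne_zero (eq_zero_of_mulVec_eq_zero hs hE₁ hA₁)

end IsJordanChain

end Chains

end Pencil

/-- The canonical embedding of the real or complex numbers into `ℂ`. -/
noncomputable def complexEmbedding (𝕂 : Type*) [RCLike 𝕂] : 𝕂 →+* ℂ where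
  toFun := RCLike.map 𝕂 ℂ
  map_zero' := map_zero _
  map_add' := map_add _
  map_one' := by simp
  map_mul' x y := by apply Complex.ext <;> simp

/-- `ℂ` as an algebra over the real or complex numbers.  It is not an instance, since it would
compete with the existing ones for `𝕂 = ℝ` and `𝕂 = ℂ`. -/
noncomputable abbrev complexAlgebra (𝕂 : Type*) [RCLike 𝕂] : Algebra 𝕂 ℂ :=
  (complexEmbedding 𝕂).toAlgebra

namespace LinRel

open scoped Matrix

variable {𝕂 : Type*} [RCLike 𝕂] {n : ℕ}

section Complexification

variable [Algebra 𝕂 ℂ]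

/-- The complexification of a linear relation `M` in `𝕂ⁿ`.  A pair of complex vectors belongs to it
if every `𝕂`-linear functional `ℂ → 𝕂`, applied to all entries, maps the pair into `M`; for `𝕂 = ℝ`
this says that the pairs of the real parts and of the imaginary parts belong to `M`. -/
def complexify (M : LinRel 𝕂 n) : LinRel ℂ n where
  carrier := {p | ∀ f : ℂ →ₗ[𝕂] 𝕂, (f ∘ p.1, f ∘ p.2) ∈ M}
  add_mem' {p q} hp hq f := by
    convert M.add_mem (hp f) (hq f) using 1
    ext i <;> simp
  zero_mem' f := by
    convert M.zero_mem using 1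
    ext i <;> simp
  smul_mem' c p hp f := hp (f ∘ₗ LinearMap.mulLeft 𝕂 c)

variable {m : ℕ} {e : ℂ ≃ₗ[𝕂] (Fin m → 𝕂)} {M : LinRel 𝕂 n}

theorem mem_complexify_iff (e : ℂ ≃ₗ[𝕂] (Fin m → 𝕂)) {x y : Fin n → ℂ} :
    (x, y) ∈ M.complexify ↔ ∀ k, ((fun i => e (x i) k, fun i => e (y i) k) : _ × _) ∈ M := by
  constructor
  · intro h k
    exact h ((LinearMap.proj k : (Fin m → 𝕂) →ₗ[𝕂] 𝕂) ∘ₗ e.toLinearMap)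
  · intro h f
    obtain ⟨c, hc⟩ : ∃ c : Fin m → 𝕂, ∀ u, f u = ∑ k, c k * e u k :=
      ⟨fun k => f (e.symm fun j => if k = j then 1 else 0), fun u => by
        simpa [mul_comm] using (f ∘ₗ e.symm.toLinearMap).pi_apply_eq_sum_univ (e u)⟩
    convert M.sum_mem fun k (_ : k ∈ Finset.univ) => M.smul_mem (c k) (h k) using 1
    ext i <;> simp [hc, Prod.fst_sum, Prod.snd_sum]

theorem re_sp_eq_sum (he : ∀ u v, (u * star v).re = RCLike.re (sp (e u) (e v)))
    (x y : Fin n → ℂ) :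
    (sp x y).re = ∑ k, RCLike.re (sp (fun i => e (x i) k) fun i => e (y i) k) := by
  simp only [sp, dotProduct, map_sum, Pi.star_apply, Complex.re_sum] at he ⊢
  rw [Finset.sum_comm]
  exact Finset.sum_congr rfl fun i _ => by rw [mul_comm, he]

theorem IsDissipative.complexify (he : ∀ u v, (u * star v).re = RCLike.re (sp (e u) (e v)))
    (hM : M.IsDissipative) : M.complexify.IsDissipative := fun x y h => by
  rw [RCLike.re_eq_complex_re, re_sp_eq_sum he]
  exact Finset.sum_nonpos fun k _ => hM _ _ ((mem_complexify_iff e).mp h k)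

theorem IsSymmetric.complexify (he : ∀ u v, (u * star v).re = RCLike.re (sp (e u) (e v)))
    (hM : M.IsSymmetric) : M.complexify.IsSymmetric := by
  rintro ⟨x, y⟩ hxy v w hvw
  have hre {v w : Fin n → ℂ} (h : (v, w) ∈ M.complexify) : (sp w x).re = (sp v y).re := by
    rw [re_sp_eq_sum he, re_sp_eq_sum he]
    exact Finset.sum_congr rfl fun k _ => congrArg RCLike.re <|
      hM ((mem_complexify_iff e).mp hxy k) _ _ ((mem_complexify_iff e).mp h k)
  refine Complex.ext (hre hvw) ?_
  simpa using hre (M.complexify.smul_mem Complex.I hvw)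

theorem IsNonneg.complexify (he : ∀ u v, (u * star v).re = RCLike.re (sp (e u) (e v)))
    (hM : M.IsNonneg) : M.complexify.IsNonneg := by
  refine ⟨hM.1.complexify he, fun x y h => Complex.nonneg_iff.mpr ⟨?_, ?_⟩⟩
  · rw [re_sp_eq_sum he]
    exact Finset.sum_nonneg fun k _ =>
      (RCLike.nonneg_iff.mp (hM.2 _ _ ((mem_complexify_iff e).mp h k))).1
  · have hreal : star (sp x y) = sp x y := (star_sp x y).trans (hM.1.complexify he h x y h)
    exact (Complex.conj_eq_iff_im.mp hreal).symm

theorem IsDefinite.complexify (he : ∀ u v, (u * star v).re = RCLike.re (sp (e u) (e v)))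
    (hM : M.IsNonneg) (hdef : M.IsDefinite) : M.complexify.IsDefinite := by
  intro x y hxy h0
  have hcoord := (mem_complexify_iff e).mp hxy
  have hnonneg k := RCLike.nonneg_iff.mp (hM.2 _ _ (hcoord k))
  have hsum : ∑ k, RCLike.re (sp (fun i => e (x i) k) fun i => e (y i) k) = 0 := by
    rw [← re_sp_eq_sum he, h0, Complex.zero_re]
  rw [Finset.sum_eq_zero_iff_of_nonneg fun k _ => (hnonneg k).1] at hsum
  have hzero k := hdef _ _ (hcoord k) <| RCLike.ext
    ((hsum k (Finset.mem_univ k)).trans (map_zero _).symm) ((hnonneg k).2.trans (map_zero _).symm)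
  constructor <;> ext i <;> rw [Pi.zero_apply, ← e.map_eq_zero_iff] <;> ext k
  · exact congrFun (hzero k).1 i
  · exact congrFun (hzero k).2 i

theorem complexify_prod (e : ℂ ≃ₗ[𝕂] (Fin m → 𝕂)) (M N : LinRel 𝕂 n) :
    (M.prod N).complexify = M.complexify.prod N.complexify := by
  ext ⟨x, z⟩
  constructor
  · intro h
    choose y hN hM using (mem_complexify_iff e).mp h
    refine ⟨fun i => e.symm fun k => y k i, ?_, ?_⟩ <;> rw [mem_complexify_iff e] <;> simpa
  · rintro ⟨y, hN, hM⟩ f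
    exact ⟨f ∘ y, hN f, hM f⟩

theorem comp_map_algebraMap_mulVec (f : ℂ →ₗ[𝕂] 𝕂)
    (B : Matrix (Fin n) (Fin n) 𝕂) (z : Fin n → ℂ) :
    f ∘ (B.map (algebraMap 𝕂 ℂ) *ᵥ z) = B *ᵥ (f ∘ z) := by
  ext i
  simp [Matrix.mulVec, dotProduct, ← Algebra.smul_def]

theorem complexify_ranPair (e : ℂ ≃ₗ[𝕂] (Fin m → 𝕂)) (E A : Matrix (Fin n) (Fin n) 𝕂) :
    (ranPair E A).complexify =
      ranPair (E.map (algebraMap 𝕂 ℂ)) (A.map (algebraMap 𝕂 ℂ)) := by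
  ext ⟨x, y⟩
  constructor
  · intro h
    choose z hz using (mem_complexify_iff e).mp h
    refine ⟨fun i => e.symm fun k => z k i, ?_⟩
    have hcoord (B : Matrix (Fin n) (Fin n) 𝕂) (k : Fin m) (i : Fin n) :
        e ((B.map (algebraMap 𝕂 ℂ) *ᵥ fun i => e.symm fun k => z k i) i) k = (B *ᵥ z k) i := by
      let f : ℂ →ₗ[𝕂] 𝕂 := LinearMap.proj k ∘ₗ e.toLinearMap
      simpa [f, Function.comp_def] using
        congrFun (comp_map_algebraMap_mulVec f B fun i => e.symm fun k => z k i) i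
    refine Prod.ext (funext fun i => e.injective (funext fun k => ?_))
      (funext fun i => e.injective (funext fun k => ?_))
    · exact (hcoord E k i).trans (congrFun (congrArg Prod.fst (hz k)) i)
    · exact (hcoord A k i).trans (congrFun (congrArg Prod.snd (hz k)) i)
  · rintro ⟨z, hz⟩ f
    obtain ⟨rfl, rfl⟩ := Prod.ext_iff.mp hz
    exact ⟨f ∘ z, Prod.ext (comp_map_algebraMap_mulVec f E z).symm
      (comp_map_algebraMap_mulVec f A z).symm⟩

end Complexification

theorem exists_orthonormal_coordinates (𝕂 : Type*) [RCLike 𝕂] :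
    let := complexAlgebra 𝕂
    ∃ (m : ℕ) (e : ℂ ≃ₗ[𝕂] (Fin m → 𝕂)),
      ∀ u v, (u * star v).re = RCLike.re (sp (e u) (e v)) := by
  intro
  have hsmul (c : 𝕂) (u : ℂ) : c • u = RCLike.map 𝕂 ℂ c * u := rfl
  rcases RCLike.I_eq_zero_or_im_I_eq_one (K := 𝕂) with hI | hI
  · have hre (c : 𝕂) : (RCLike.re c : 𝕂) = c := by simpa [hI] using RCLike.re_add_im c
    refine ⟨2,
      { toFun := fun u => ![(u.re : 𝕂), (u.im : 𝕂)]
        invFun := fun v => ⟨RCLike.re (v 0), RCLike.re (v 1)⟩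
        map_add' := fun u v => by ext k; fin_cases k <;> simp
        map_smul' := fun c u => by
          ext k; fin_cases k <;> simp [hsmul, RCLike.im_eq_zero hI, hre]
        left_inv := fun u => by simp
        right_inv := fun v => by
          ext k; fin_cases k <;> simp [hre] }, fun u v => ?_⟩
    simp [sp, dotProduct, mul_comm]
  · refine ⟨1,
      { toFun := fun u _ => RCLike.map ℂ 𝕂 u
        invFun := fun v => RCLike.map 𝕂 ℂ (v 0)
        map_add' := fun u v => by ext; simp only [map_add, Pi.add_apply]
        map_smul' := fun c u => by
          ext; simp [hsmul, RCLike.ext_iff, hI]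
        left_inv := fun u => by simp [hI]
        right_inv := fun v => by
          ext k; fin_cases k; simp }, fun u v => ?_⟩
    simp [sp, dotProduct, hI, mul_comm]

theorem exists_complexification {E A : Matrix (Fin n) (Fin n) 𝕂} {𝒟 ℒ : LinRel 𝕂 n}
    (h𝒟 : 𝒟.IsDissipative) (hℒ : ℒ.IsNonneg) (hran : ranPair E A = 𝒟.prod ℒ) :
    ∃ D L : LinRel ℂ n, D.IsDissipative ∧ L.IsNonneg ∧
      ranPair (Pencil.toComplex E) (Pencil.toComplex A) = D.prod L ∧
      (ℒ.IsDefinite → L.IsDefinite) := by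
  let := complexAlgebra 𝕂
  obtain ⟨m, e, he⟩ := exists_orthonormal_coordinates 𝕂
  refine ⟨𝒟.complexify, ℒ.complexify, h𝒟.complexify he, hℒ.complexify he, ?_,
    IsDefinite.complexify he hℒ⟩
  rw [← complexify_prod e, ← hran, complexify_ranPair e]
  rfl

end LinRel

namespace Pencil

open scoped Matrix

section Regularity

variable {𝕂 : Type*} [RCLike 𝕂] {n : ℕ} {E A : Matrix (Fin n) (Fin n) 𝕂}

theorem IsRegular.exists_isUnit (h : IsRegular E A) :
    ∃ s : ℂ, IsUnit (s • toComplex E - toComplex A) := by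
  obtain ⟨s, hs⟩ : ∃ s : ℂ, Polynomial.eval₂RingHom (complexEmbedding 𝕂) s
      ((Polynomial.X : Polynomial 𝕂) • E.map Polynomial.C - A.map Polynomial.C).det ≠ 0 := by
    by_contra! hzero
    refine h (Polynomial.map_injective _ (complexEmbedding 𝕂).injective
      (Polynomial.funext fun s => ?_))
    simpa [Polynomial.eval_map] using hzero s
  refine ⟨s, (Matrix.isUnit_iff_isUnit_det _).mpr (isUnit_iff_ne_zero.mpr ?_)⟩
  rw [RingHom.map_det] at hs
  convert hs using 2
  ext i j
  simp [toComplex, complexEmbedding, mul_comm s]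

theorem exists_eigenvector {μ : ℂ} (h : μ ∈ spectrum E A) :
    ∃ z ≠ 0, toComplex A *ᵥ z = μ • toComplex E *ᵥ z := by
  have hlt : (μ • toComplex E - toComplex A).rank < n := h.trans_le (Matrix.rank_le_width _)
  have hdet : (μ • toComplex E - toComplex A).det = 0 := by
    by_contra hne
    have hunit := (Matrix.isUnit_iff_isUnit_det _).mpr (isUnit_iff_ne_zero.mpr hne)
    rw [Matrix.rank_of_isUnit _ hunit, Fintype.card_fin] at hlt
    exact hlt.false
  obtain ⟨z, hz, h0⟩ := Matrix.exists_mulVec_eq_zero_iff.mpr hdet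
  rw [Matrix.sub_mulVec, Matrix.smul_mulVec, sub_eq_zero] at h0
  exact ⟨z, hz, h0.symm⟩

end Regularity

section JordanBlocks

theorem IsJordanChain.of_mul_eq_mul {R l m n m' n' : Type*} [CommSemiring R] [Fintype m]
    [Fintype n] [Fintype m'] [Fintype n'] {E A : Matrix m n R} {E' A' : Matrix m' n' R}
    {S : Matrix l m R} {P : Matrix n n' R} {Q : Matrix l m' R} {μ : R} {k : ℕ} {x : ℕ → n' → R}
    (hx : IsJordanChain E' A' μ k x) (hS : Function.Injective S.mulVec)
    (hP : Function.Injective P.mulVec) (hE : S * E * P = Q * E') (hA : S * A * P = Q * A') :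
    IsJordanChain E A μ k fun a => P *ᵥ x a where
  zero := by rw [hx.zero, Matrix.mulVec_zero]
  one_ne_zero h := hx.one_ne_zero (hP (h.trans (Matrix.mulVec_zero P).symm))
  mulVec_succ a ha := by
    have hE' (v : n' → R) : S *ᵥ (E *ᵥ (P *ᵥ v)) = Q *ᵥ (E' *ᵥ v) := by
      simp only [Matrix.mulVec_mulVec, ← Matrix.mul_assoc, hE]
    have hA' (v : n' → R) : S *ᵥ (A *ᵥ (P *ᵥ v)) = Q *ᵥ (A' *ᵥ v) := by
      simp only [Matrix.mulVec_mulVec, ← Matrix.mul_assoc, hA]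
    apply hS
    simp only [Matrix.mulVec_add, Matrix.mulVec_smul, hE', hA', hx.mulVec_succ a ha]

theorem exists_isJordanChain_jordanBlock {k : ℕ} (hk : 0 < k) (μ : ℂ) :
    ∃ x, IsJordanChain 1 (jordanBlock k μ) μ k x := by
  refine ⟨fun a j => if a = j + 1 then 1 else 0, ?_, ?_, fun a ha => ?_⟩
  · ext j
    simp
  · exact fun h => by simpa using congrFun h ⟨0, hk⟩
  · ext i
    have hcol : (jordanBlock k μ *ᵥ fun j => if a + 1 = (j : ℕ) + 1 then 1 else 0) i =
        jordanBlock k μ i ⟨a, ha⟩ := by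
      rw [Matrix.mulVec, dotProduct, Finset.sum_eq_single ⟨a, ha⟩] <;>
        simp +contextual [Fin.ext_iff, eq_comm]
    rw [hcol]
    simp only [jordanBlock, Matrix.of_apply, Matrix.one_mulVec, Pi.add_apply, Pi.smul_apply,
      smul_eq_mul, Fin.ext_iff]
    grind

namespace WeierstrassForm

variable {n : ℕ} {E A : Matrix (Fin n) (Fin n) ℂ} (W : WeierstrassForm E A)

theorem injective_mulVec_S : Function.Injective W.S.mulVec :=
  Matrix.mulVec_injective_iff_isUnit.mpr W.isUnit_S

theorem injective_mulVec_columns_T {ι : Type*} [Fintype ι] {g : ι → Fin n}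
    (hg : Function.Injective g) : Function.Injective (W.T.submatrix id g).mulVec := by
  rw [Matrix.mulVec_injective_iff]
  exact (Matrix.linearIndependent_cols_of_isUnit W.isUnit_T).comp g hg

theorem exists_isJordanChain (i : Fin W.numFin) :
    ∃ x, IsJordanChain E A (W.eig i) (W.finSize i) x := by
  let g (c : Fin (W.finSize i)) : Fin n := W.e (Sum.inl ⟨i, c⟩)
  let Q : Matrix (Fin n) (Fin (W.finSize i)) ℂ :=
    Matrix.of fun r c => if W.e.symm r = Sum.inl ⟨i, c⟩ then 1 else 0
  have hg : Function.Injective g := fun c d h => by simpa [g] using h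
  have hE : W.S * E * W.T.submatrix id g = Q := by
    change (W.S * E * W.T).submatrix id g = _
    rw [W.leading]
    ext r c
    obtain ⟨r | r, rfl⟩ := W.e.surjective r
    · simp only [g, Q, Matrix.submatrix_apply, Matrix.of_apply, id_eq, Matrix.reindex_apply,
        Equiv.symm_apply_apply, Matrix.fromBlocks_apply₁₁, Matrix.one_apply, Sum.inl.injEq]
    · simp [g, Q]
  have hA : W.S * A * W.T.submatrix id g = Q * jordanBlock (W.finSize i) (W.eig i) := by
    change (W.S * A * W.T).submatrix id g = _
    rw [W.constant]
    ext r c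
    obtain ⟨⟨i', r⟩ | r, rfl⟩ := W.e.surjective r
    · rcases eq_or_ne i' i with rfl | hi <;>
        simp [g, Q, Matrix.mul_apply, Matrix.blockDiagonal'_apply, *]
    · simp [g, Q, Matrix.mul_apply]
  obtain ⟨x, hx⟩ := exists_isJordanChain_jordanBlock (W.finSize_pos i) (W.eig i)
  exact ⟨_, hx.of_mul_eq_mul W.injective_mulVec_S (W.injective_mulVec_columns_T hg)
    (hE.trans (Matrix.mul_one Q).symm) hA⟩

theorem exists_isJordanChain_at_infinity (j : Fin W.numInf) :
    ∃ x, IsJordanChain A E 0 (W.infSize j) x := by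
  let g (c : Fin (W.infSize j)) : Fin n := W.e (Sum.inr ⟨j, c⟩)
  let Q : Matrix (Fin n) (Fin (W.infSize j)) ℂ :=
    Matrix.of fun r c => if W.e.symm r = Sum.inr ⟨j, c⟩ then 1 else 0
  have hg : Function.Injective g := fun c d h => by simpa [g] using h
  have hE : W.S * E * W.T.submatrix id g = Q * jordanBlock (W.infSize j) 0 := by
    change (W.S * E * W.T).submatrix id g = _
    rw [W.leading]
    ext r c
    obtain ⟨r | ⟨j', r⟩, rfl⟩ := W.e.surjective r
    · simp [g, Q, Matrix.mul_apply]
    · rcases eq_or_ne j' j with rfl | hj <;>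
        simp [g, Q, Matrix.mul_apply, Matrix.blockDiagonal'_apply, *]
  have hA : W.S * A * W.T.submatrix id g = Q := by
    change (W.S * A * W.T).submatrix id g = _
    rw [W.constant]
    ext r c
    obtain ⟨r | r, rfl⟩ := W.e.surjective r
    · simp [g, Q]
    · simp only [g, Q, Matrix.submatrix_apply, Matrix.of_apply, id_eq, Matrix.reindex_apply,
        Equiv.symm_apply_apply, Matrix.fromBlocks_apply₂₂, Matrix.one_apply, Sum.inr.injEq]
  obtain ⟨x, hx⟩ := exists_isJordanChain_jordanBlock (W.infSize_pos j) 0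
  exact ⟨_, hx.of_mul_eq_mul W.injective_mulVec_S (W.injective_mulVec_columns_T hg)
    (hA.trans (Matrix.mul_one Q).symm) hE⟩

end WeierstrassForm

variable {𝕂 : Type*} [RCLike 𝕂] {n : ℕ} {E A : Matrix (Fin n) (Fin n) 𝕂} {k : ℕ}

theorem HasJordanBlock.exists_isJordanChain {μ : ℂ} (h : HasJordanBlock E A μ k) :
    ∃ x, IsJordanChain (toComplex E) (toComplex A) μ k x := by
  obtain ⟨W, i, rfl, rfl⟩ := h
  exact W.exists_isJordanChain i

theorem HasJordanBlockAtInfinity.exists_isJordanChain (h : HasJordanBlockAtInfinity E A k) :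
    ∃ x, IsJordanChain (toComplex A) (toComplex E) 0 k x := by
  obtain ⟨W, j, rfl⟩ := h
  exact W.exists_isJordanChain_at_infinity j

theorem index_le {d : ℕ} (h : ∀ k, HasJordanBlockAtInfinity E A k → k ≤ d) : index E A ≤ d :=
  csSup_le' h

theorem isSemisimple_of_forall_le_one {μ : ℂ} (h : ∀ k, HasJordanBlock E A μ k → k ≤ 1) :
    IsSemisimple E A μ :=
  fun k hk hblock => (hk.trans (h k hblock)).not_gt one_lt_two

end JordanBlocks

end Pencil

theorem proposition6p3_general {𝕂 : Type*} [RCLike 𝕂] {n : ℕ}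
    (E A : Matrix (Fin n) (Fin n) 𝕂) (𝒟 ℒ : LinRel 𝕂 n)
    (h𝒟 : 𝒟.IsDissipative) (hℒ : ℒ.IsNonneg)
    (hran : LinRel.ranPair E A = 𝒟.prod ℒ)
    (hreg : Pencil.IsRegular E A) :
    ((∀ μ ∈ Pencil.spectrum E A, μ.re ≤ 0) ∧
      (∀ μ ∈ Pencil.spectrum E A, μ.re = 0 → μ ≠ 0 → Pencil.IsSemisimple E A μ) ∧
      (∀ k, Pencil.HasJordanBlock E A 0 k → k ≤ 2)) ∧
    Pencil.index E A ≤ 3 ∧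
    (ℒ.IsDefinite → Pencil.index E A ≤ 1 ∧ Pencil.IsSemisimple E A 0) := by
  obtain ⟨s, hs⟩ := hreg.exists_isUnit
  obtain ⟨D, L, hD, hL, hran, hdef⟩ := LinRel.exists_complexification h𝒟 hℒ hran
  refine ⟨⟨fun μ hμ => ?_, fun μ _ hre hne => ?_, fun k hk => ?_⟩, ?_, fun hℒdef => ⟨?_, ?_⟩⟩
  · obtain ⟨z, hz, hA⟩ := Pencil.exists_eigenvector hμ
    exact Pencil.re_nonpos_of_eigenvector hD hL hran hs hz hA
  · refine Pencil.isSemisimple_of_forall_le_one fun k hk => ?_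
    obtain ⟨x, hx⟩ := hk.exists_isJordanChain
    exact hx.length_le_one_of_re_eq_zero hD hL hran hs hre hne
  · obtain ⟨x, hx⟩ := hk.exists_isJordanChain
    exact hx.length_le_two hD hL hran hs
  · refine Pencil.index_le fun k hk => ?_
    obtain ⟨x, hx⟩ := hk.exists_isJordanChain
    exact hx.length_le_three hD hL hran hs
  · refine Pencil.index_le fun k hk => ?_
    obtain ⟨x, hx⟩ := hk.exists_isJordanChain
    exact hx.length_le_one_of_isDefinite_at_infinity hD (hdef hℒdef) hran hs
  · refine Pencil.isSemisimple_of_forall_le_one fun k hk => ?_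
    obtain ⟨x, hx⟩ := hk.exists_isJordanChain
    exact hx.length_le_one_of_isDefinite hD (hdef hℒdef) hran hs

theorem proposition6p3 {𝕂 : Type*} [RCLike 𝕂] {n : ℕ}
    (E A : Matrix (Fin n) (Fin n) 𝕂) (𝒟 ℒ : LinRel 𝕂 n)
    (h𝒟 : 𝒟.IsDissipative) (hℒ : ℒ.IsNonneg)
    (hran : LinRel.ranPair E A = 𝒟.prod ℒ)
    (hreg : Pencil.IsRegular E A) :
    ((∀ μ ∈ Pencil.spectrum E A, μ.re ≤ 0) ∧
      (∀ μ ∈ Pencil.spectrum E A, μ.re = 0 → μ ≠ 0 → Pencil.IsSemisimple E A μ) ∧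
      (∀ k, Pencil.HasJordanBlock E A 0 k → k ≤ 2)) ∧
    Pencil.index E A ≤ 3 ∧
    (𝒟.IsMaxDissipative →
      (∃ L : Matrix (Fin n) (Fin n) 𝕂, L.PosDef ∧ ℒ = (LinRel.gr L).inverse) →
      Pencil.index E A ≤ 1 ∧ Pencil.IsSemisimple E A 0) := by
  obtain ⟨ha, hb, hc⟩ := proposition6p3_general E A 𝒟 ℒ h𝒟 hℒ hran hreg
  exact ⟨ha, hb, by rintro - ⟨L, hL, rfl⟩; exact hc (LinRel.isDefinite_inverse_gr hL)⟩
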